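/- For a metric space $(Y,d)$ with basepoint $y_0\in Y$, let $\mathrm{Lip}_0(Y)$ be the space of Lipschitz functions $f:Y\to\mathbb{R}$ with $f(y_0)=0$, normed by $\|f\|=\sup_{p\neq q}\frac{|f(p)-f(q)|}{d(p,q)}$. The Lipschitz free space $\mathcal{F}(Y)$ is the norm-closed linear span of the evaluations $\delta_p(f)=f(p)$, $p\in Y$, in the dual $\mathrm{Lip}_0(Y)^*$; up to linear isometry it does not depend on the basepoint, and $\mathcal{F}(\emptyset):=\{0\}$. A Banach space has the Schur property if every weakly null sequence in it is norm null. Let $X$ be a complete metric space, and let $\mathcal{I}$ be an ideal of closed subsets of $X$, i.e. a collection of closed subsets of $X$ such that $\emptyset\in\mathcal{I}$; if $B\in\mathcal{I}$ and $A\subseteq B$ is closed in $X$, then $A\in\mathcal{I}$; and if $A,B\in\mathcal{I}$, then $A\cup B\in\mathcal{I}$. Suppose that $X$ is locally-$\mathcal{I}$: for every $p\in X$ there is $\theta>0$ such that the closed ball $\{x\in X: d(x,p)\le\theta\}$ belongs to $\mathcal{I}$. \textbf{Theorem.} If $\mathcal{F}(A)$ has the Schur property for every $A\in\mathcal{I}$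 (with the metric restricted from $X$), then $\mathcal{F}(X)$ has the Schur property. -/

import Mathlib

open Filter Topology

noncomputable section

/-- The real Lipschitz functions on `X` vanishing at the basepoint `x₀`, as a vector space of
functions. -/
def lipZeroSubmodule (X : Type*) [MetricSpace X] (x₀ : X) : Submodule ℝ (X → ℝ) where
  carrier := {f | (∃ K, LipschitzWith K f) ∧ f x₀ = 0}
  zero_mem' := ⟨⟨0, LipschitzWith.const 0⟩, rfl⟩
  add_mem' := by
    rintro f g ⟨⟨K, hK⟩, hf⟩ ⟨⟨L, hL⟩, hg⟩
    exact ⟨⟨K + L, hK.add hL⟩, by simp [hf, hg]⟩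
  smul_mem' := by
    rintro c f ⟨⟨K, hK⟩, hf⟩
    refine ⟨⟨‖c‖₊ * K, ?_⟩, by simp [hf]⟩
    exact (lipschitzWith_smul c).comp hK

/-- The space `Lip₀(X)`. It is a type of its own so that it carries the Lipschitz norm and not the
topology of pointwise convergence. -/
def LipZero (X : Type*) [MetricSpace X] (x₀ : X) : Type _ := ↥(lipZeroSubmodule X x₀)

namespace LipZero

instance (X : Type*) [MetricSpace X] (x₀ : X) : AddCommGroup (LipZero X x₀) :=
  inferInstanceAs (AddCommGroup ↥(lipZeroSubmodule X x₀))

instance (X : Type*) [MetricSpace X] (x₀ : X) : Module ℝ (LipZero X x₀) :=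
  inferInstanceAs (Module ℝ ↥(lipZeroSubmodule X x₀))

instance (X : Type*) [MetricSpace X] (x₀ : X) : CoeFun (LipZero X x₀) (fun _ => X → ℝ) :=
  ⟨fun f => f.1⟩

/-- The norm `‖f‖ = sup_{p ≠ q} |f(p) - f(q)| / d(p, q)`; the supremum is finite by
`LipZero.bddAbove`, and it is `0` on a one-point space. -/
instance (X : Type*) [MetricSpace X] (x₀ : X) : Norm (LipZero X x₀) :=
  ⟨fun f => ⨆ z : {z : X × X // z.1 ≠ z.2}, |f z.1.1 - f z.1.2| / dist z.1.1 z.1.2⟩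

theorem norm_def {X : Type*} [MetricSpace X] {x₀ : X} (f : LipZero X x₀) :
    ‖f‖ = ⨆ z : {z : X × X // z.1 ≠ z.2}, |f z.1.1 - f z.1.2| / dist z.1.1 z.1.2 := rfl

theorem bddAbove {X : Type*} [MetricSpace X] {x₀ : X} (f : LipZero X x₀) :
    BddAbove (Set.range fun z : {z : X × X // z.1 ≠ z.2} =>
      |f z.1.1 - f z.1.2| / dist z.1.1 z.1.2) := by
  obtain ⟨K, hK⟩ := f.2.1
  refine ⟨K, ?_⟩
  rintro _ ⟨z, rfl⟩
  have h := hK.dist_le_mul z.1.1 z.1.2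
  rw [Real.dist_eq] at h
  exact div_le_of_le_mul₀ dist_nonneg K.2 h

theorem norm_nonneg' {X : Type*} [MetricSpace X] {x₀ : X} (f : LipZero X x₀) : 0 ≤ ‖f‖ :=
  Real.iSup_nonneg fun _ => by positivity

theorem abs_sub_le {X : Type*} [MetricSpace X] {x₀ : X} (f : LipZero X x₀) (p q : X) :
    |f p - f q| ≤ ‖f‖ * dist p q := by
  by_cases h : p = q
  · simp [h]
  · have := le_ciSup (bddAbove f) ⟨(p, q), h⟩
    exact (div_le_iff₀ (dist_pos.2 h)).1 this

theorem norm_le {X : Type*} [MetricSpace X] {x₀ : X} (f : LipZero X x₀) {C : ℝ} (hC : 0 ≤ C)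
    (h : ∀ p q, |f p - f q| ≤ C * dist p q) : ‖f‖ ≤ C :=
  Real.iSup_le (fun z => div_le_of_le_mul₀ dist_nonneg hC (h z.1.1 z.1.2)) hC

theorem normCore (X : Type*) [MetricSpace X] (x₀ : X) : NormedSpace.Core ℝ (LipZero X x₀) where
  norm_nonneg := norm_nonneg'
  norm_smul c f := by
    change (⨆ z : {z : X × X // z.1 ≠ z.2},
      |c * f z.1.1 - c * f z.1.2| / dist z.1.1 z.1.2) = ‖c‖ * ‖f‖
    rw [norm_def, Real.mul_iSup_of_nonneg (norm_nonneg c)]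
    simp only [← mul_sub, abs_mul, mul_div_assoc, Real.norm_eq_abs]
  norm_triangle f g := by
    refine norm_le _ (add_nonneg (norm_nonneg' f) (norm_nonneg' g)) fun p q => ?_
    change |(f p + g p) - (f q + g q)| ≤ _
    have hf := abs_sub_le f p q
    have hg := abs_sub_le g p q
    calc |(f p + g p) - (f q + g q)| = |(f p - f q) + (g p - g q)| := by ring_nf
      _ ≤ |f p - f q| + |g p - g q| := abs_add_le _ _
      _ ≤ _ := by rw [add_mul]; exact add_le_add hf hg
  norm_eq_zero_iff f := by
    constructor
    · intro h
      refine Subtype.ext (funext fun p => ?_)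
      have hp := abs_sub_le f p x₀
      rw [h, zero_mul, f.2.2, sub_zero] at hp
      exact abs_nonpos_iff.1 hp
    · rintro rfl
      refine le_antisymm (norm_le _ le_rfl fun p q => ?_) (norm_nonneg' _)
      change |(0 : ℝ) - 0| ≤ _
      simp

instance (X : Type*) [MetricSpace X] (x₀ : X) : NormedAddCommGroup (LipZero X x₀) :=
  NormedAddCommGroup.ofCore (normCore X x₀)

instance (X : Type*) [MetricSpace X] (x₀ : X) : NormedSpace ℝ (LipZero X x₀) :=
  NormedSpace.ofCore (normCore X x₀)

/-- The evaluation functional `δ_p(f) = f(p)` in the dual of `Lip₀(X)`. -/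
def delta {X : Type*} [MetricSpace X] (x₀ : X) (p : X) : StrongDual ℝ (LipZero X x₀) :=
  LinearMap.mkContinuous
    { toFun := fun f => f p
      map_add' := fun _ _ => rfl
      map_smul' := fun _ _ => rfl } (dist p x₀) (fun f => by
        have h := abs_sub_le f p x₀
        rw [f.2.2, sub_zero, mul_comm] at h
        exact h)

@[simp]
theorem delta_apply {X : Type*} [MetricSpace X] (x₀ : X) (p : X) (f : LipZero X x₀) :
    delta x₀ p f = f p := rfl

end LipZero

/-- The Lipschitz free space over `X` with basepoint `x₀`: the norm closure of the linear span of
the evaluations `δ_p`, `p ∈ X`, in the dual of `Lip₀(X)`. -/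
def LipFree (X : Type*) [MetricSpace X] (x₀ : X) : Submodule ℝ (StrongDual ℝ (LipZero X x₀)) :=
  (Submodule.span ℝ (Set.range (LipZero.delta x₀))).topologicalClosure

/-- The Schur property: every weakly null sequence is norm null. -/
def SchurProperty (V : Type*) [NormedAddCommGroup V] [NormedSpace ℝ V] : Prop :=
  ∀ v : ℕ → V, (∀ φ : StrongDual ℝ V, Tendsto (fun n => φ (v n)) atTop (𝓝 0)) →
    Tendsto v atTop (𝓝 0)

/-- A closed set `E` is locally modeled on a collection `I` of closed sets if every point `p` of `E`
has a closed ball `B` around it, of positive radius, with `E ∩ B` in `I`. -/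
def LocallyModeledOn {X : Type*} [MetricSpace X] (I : Set (TopologicalSpace.Closeds X))
    (E : TopologicalSpace.Closeds X) : Prop :=
  ∀ p ∈ E, ∃ θ : ℝ, 0 < θ ∧ E ⊓ ⟨Metric.closedBall p θ, Metric.isClosed_closedBall⟩ ∈ I

end

/-!
A gliding hump argument shows that a weakly null sequence in the free space is uniformly small on
the unit-ball functions vanishing on a neighbourhood `{x | d(x, E ∪ {x₀}) ≤ δ (1 + d(x, x₀))}` of
some finite set `E`: otherwise one finds disjointly supported humps whose sum is a Lipschitz
function along which the sequence does not tend to `0`. The width of these neighbourhoods grows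
linearly at infinity, so multiplication by a cutoff to them is bounded on `Lip₀(X)` by a constant
depending on `δ` only, and the smallness may therefore be prescribed after `δ`. Multiplying
successively by cutoffs for `δ₀, δ₁, … → 0` changes the sequence by as little as desired and leaves
a weakly null sequence supported on the intersection of the neighbourhoods, which is compact. The
free space of that compact set embeds isometrically in the free space of `X`, and compact sets
belong to any ideal on which `X` is locally modeled.
-/

noncomputable section

theorem tendsto_zero_of_forall_exists_norm_sub_le {ι E : Type*} [SeminormedAddCommGroup E]
    {l : Filter ι} {u : ι → E}
    (h : ∀ ε > 0, ∃ v : ι → E, Tendsto v l (𝓝 0) ∧ ∀ i, ‖u i - v i‖ ≤ ε) : Tendsto u l (𝓝 0) := by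
  refine NormedAddGroup.tendsto_nhds_zero.2 fun ε hε => ?_
  obtain ⟨v, hv, huv⟩ := h (ε / 2) (half_pos hε)
  filter_upwards [NormedAddGroup.tendsto_nhds_zero.1 hv (ε / 2) (half_pos hε)] with i hi
  linarith [norm_le_norm_add_norm_sub' (u i) (v i), huv i]

theorem exists_dual_eq_zero_of_notMem {E : Type*} [NormedAddCommGroup E] [NormedSpace ℝ E]
    {P : Submodule ℝ E} (hP : IsClosed (P : Set E)) {x : E} (hx : x ∉ P) :
    ∃ φ : StrongDual ℝ E, (∀ y ∈ P, φ y = 0) ∧ φ x ≠ 0 := by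
  obtain ⟨ψ, hψ⟩ := SeparatingDual.exists_ne_zero (R := ℝ)
    (mt (Submodule.Quotient.mk_eq_zero P).1 hx)
  refine ⟨ψ.comp P.mkQL, fun y hy => ?_, hψ⟩
  exact (congrArg ψ ((Submodule.Quotient.mk_eq_zero P).2 hy)).trans (map_zero ψ)

namespace LipZero

variable {X : Type*} [MetricSpace X] {x₀ : X}

@[simp] theorem apply_basepoint (f : LipZero X x₀) : f x₀ = 0 := f.2.2

@[simp] theorem add_apply (f g : LipZero X x₀) (p : X) : (f + g) p = f p + g p := rfl

@[simp] theorem sub_apply (f g : LipZero X x₀) (p : X) : (f - g) p = f p - g p := rfl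

@[simp] theorem smul_apply (c : ℝ) (f : LipZero X x₀) (p : X) : (c • f) p = c * f p := rfl

@[simp] theorem sum_apply {ι : Type*} (s : Finset ι) (g : ι → LipZero X x₀) (p : X) :
    (∑ i ∈ s, g i) p = ∑ i ∈ s, g i p :=
  map_sum (delta x₀ p) g s

theorem ext {f g : LipZero X x₀} (h : ∀ p, f p = g p) : f = g := Subtype.ext (funext h)

theorem abs_apply_le (f : LipZero X x₀) (p : X) : |f p| ≤ ‖f‖ * dist p x₀ := by
  simpa only [apply_basepoint, sub_zero] using abs_sub_le f p x₀

theorem lipschitzWith_nnnorm (f : LipZero X x₀) : LipschitzWith ‖f‖₊ fun p => f p :=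
  LipschitzWith.of_dist_le_mul (abs_sub_le f)

/-- The element of `Lip₀(X)` given by a Lipschitz function vanishing at the basepoint. -/
def ofLipschitzWith {K : NNReal} (g : X → ℝ) (hg : LipschitzWith K g) (h₀ : g x₀ = 0) :
    LipZero X x₀ :=
  ⟨g, ⟨K, hg⟩, h₀⟩

@[simp] theorem ofLipschitzWith_apply {K : NNReal} {g : X → ℝ} (hg : LipschitzWith K g)
    (h₀ : g x₀ = 0) (p : X) : ofLipschitzWith g hg h₀ p = g p := rfl

theorem norm_ofLipschitzWith_le {K : NNReal} {g : X → ℝ} (hg : LipschitzWith K g)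
    (h₀ : g x₀ = 0) : ‖ofLipschitzWith g hg h₀‖ ≤ K :=
  norm_le _ K.2 hg.dist_le_mul

theorem norm_delta_sub_delta_le (p q : X) : ‖delta x₀ p - delta x₀ q‖ ≤ dist p q :=
  ContinuousLinearMap.opNorm_le_bound _ dist_nonneg fun f =>
    (abs_sub_le f p q).trans_eq (mul_comm _ _)

@[simp] theorem delta_basepoint : delta x₀ x₀ = 0 :=
  ContinuousLinearMap.ext apply_basepoint

theorem exists_truncation (f : LipZero X x₀) {ρ : ℝ} (hρ : 0 ≤ ρ) :
    ∃ g : LipZero X x₀, ‖g‖ ≤ ‖f‖ ∧ (∀ p, |g p| ≤ ρ) ∧ ∀ p, |f p| ≤ ρ → g p = f p := by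
  refine ⟨ofLipschitzWith _ ((f.lipschitzWith_nnnorm.const_min ρ).const_max (-ρ)) (by simp [hρ]),
    norm_ofLipschitzWith_le _ _, fun p => ?_, fun p hp => ?_⟩
  · exact abs_le.2 ⟨le_max_left _ _, max_le (neg_le_self hρ) (min_le_left _ _)⟩
  · rw [abs_le] at hp
    rw [ofLipschitzWith_apply, min_eq_right hp.2, max_eq_right hp.1]

theorem exists_extension (x₀ : X) {A : Set X} {a : A} (g : LipZero A a) :
    ∃ f : LipZero X x₀, ‖f‖ ≤ ‖g‖ ∧ ∀ p : A, f p - f a = g p := by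
  have hlip : LipschitzOnWith ‖g‖₊ (Function.extend Subtype.val (fun p => g p) 0) A := by
    refine LipschitzOnWith.of_dist_le_mul fun p hp q hq => ?_
    lift p to A using hp
    lift q to A using hq
    rw [Subtype.val_injective.extend_apply, Subtype.val_injective.extend_apply]
    exact abs_sub_le g p q
  obtain ⟨h, hh, heq⟩ := hlip.extend_real
  have hA : ∀ p : A, h p = g p := fun p => by
    rw [← heq p.2, Subtype.val_injective.extend_apply]
  refine ⟨ofLipschitzWith (K := ‖g‖₊) (fun p => h p - h x₀)
    (LipschitzWith.of_dist_le_mul fun p q => ?_) (sub_self _), norm_ofLipschitzWith_le _ _,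
    fun p => ?_⟩
  · rw [dist_sub_right]
    exact hh.dist_le_mul p q
  · rw [ofLipschitzWith_apply, ofLipschitzWith_apply, hA, hA, apply_basepoint]
    ring

theorem lipschitzWith_restrict_sub (f : LipZero X x₀) {A : Set X} (a : A) :
    LipschitzWith ‖f‖₊ fun p : A => f p - f a :=
  LipschitzWith.of_dist_le_mul fun p q => by
    rw [dist_sub_right]
    exact abs_sub_le f p q

/-- Restriction of Lipschitz functions to a subset, normalised at a new basepoint. -/
def restrictL (x₀ : X) {A : Set X} (a : A) : LipZero X x₀ →L[ℝ] LipZero A a :=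
  LinearMap.mkContinuous
    { toFun := fun f => ofLipschitzWith _ (lipschitzWith_restrict_sub f a) (sub_self _)
      map_add' := fun f g => LipZero.ext fun p => by
        simp only [ofLipschitzWith_apply, add_apply]
        ring
      map_smul' := fun c f => LipZero.ext fun p => by simp [mul_sub] } 1
    fun f => by
      rw [one_mul]
      exact norm_ofLipschitzWith_le (lipschitzWith_restrict_sub f a) (sub_self _)

theorem exists_restrictL_eq (x₀ : X) {A : Set X} {a : A} (g : LipZero A a) :
    ∃ f : LipZero X x₀, ‖f‖ ≤ ‖g‖ ∧ restrictL x₀ a f = g := by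
  obtain ⟨f, hfg, hf⟩ := exists_extension x₀ g
  exact ⟨f, hfg, LipZero.ext hf⟩

/-- At each of two given points only one summand is nonzero, so the norms do not add up. -/
theorem exists_finsum_of_pairwise_disjoint {ι : Type*} [Nonempty ι] {g : ι → LipZero X x₀} {L : ℝ}
    (hL : ∀ i, ‖g i‖ ≤ L) (hg : ∀ i j, i ≠ j → ∀ p, g i p = 0 ∨ g j p = 0) :
    ∃ G : LipZero X x₀, (∀ p, G p = ∑ᶠ i, g i p) ∧ ‖G‖ ≤ 2 * L := by
  have hL₀ : 0 ≤ L := (norm_nonneg _).trans (hL (Classical.arbitrary ι))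
  have hunique : ∀ p, ∃ i, ∀ j, j ≠ i → g j p = 0 := fun p => by
    by_cases h : ∃ i, g i p ≠ 0
    · obtain ⟨i, hi⟩ := h
      exact ⟨i, fun j hj => (hg j i hj p).resolve_right hi⟩
    · push Not at h
      exact ⟨Classical.arbitrary ι, fun j _ => h j⟩
  have hsub : ∀ i p q, |g i p - g i q| ≤ L * dist p q := fun i p q =>
    (abs_sub_le _ p q).trans (mul_le_mul_of_nonneg_right (hL i) dist_nonneg)
  have hsum : LipschitzWith ⟨2 * L, by positivity⟩ fun p => ∑ᶠ i, g i p := by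
    refine LipschitzWith.of_dist_le_mul fun p q => ?_
    obtain ⟨i, hi⟩ := hunique p
    obtain ⟨j, hj⟩ := hunique q
    rw [finsum_eq_single _ i hi, finsum_eq_single _ j hj]
    change |g i p - g j q| ≤ 2 * L * dist p q
    rw [mul_assoc, two_mul]
    obtain rfl | hij := eq_or_ne i j
    · exact (hsub i p q).trans (le_add_of_nonneg_right (by positivity))
    · have hsplit : g i p - g j q = (g i p - g i q) + (g j p - g j q) := by
        rw [hi j hij.symm, hj i hij]
        ring
      rw [hsplit]
      exact (abs_add_le _ _).trans (add_le_add (hsub i p q) (hsub j p q))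
  exact ⟨ofLipschitzWith _ hsum (by simp), fun _ => rfl, norm_ofLipschitzWith_le _ _⟩

theorem norm_sum_le_of_pairwise_disjoint {ι : Type*} {g : ι → LipZero X x₀} {L : ℝ}
    {s : Finset ι} (hs : s.Nonempty) (hL : ∀ i ∈ s, ‖g i‖ ≤ L)
    (hg : ∀ i ∈ s, ∀ j ∈ s, i ≠ j → ∀ p, g i p = 0 ∨ g j p = 0) :
    ‖∑ i ∈ s, g i‖ ≤ 2 * L := by
  have := hs.to_subtype
  obtain ⟨G, hG, hGL⟩ := exists_finsum_of_pairwise_disjoint (g := fun i : s => g i)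
    (fun i => hL i i.2) fun i j hij => hg i i.2 j j.2 (Subtype.coe_injective.ne hij)
  have hGs : G = ∑ i ∈ s, g i := LipZero.ext fun p => by
    rw [hG, finsum_eq_sum_of_fintype, sum_apply, Finset.sum_coe_sort s fun i => g i p]
  rwa [← hGs]

end LipZero

/-- A weight `w` such that `f ↦ w * f` is bounded on `Lip₀(X)`. The Lipschitz constant of `w` may
blow up near `x₀` at rate `1 / dist p x₀`, because `|f p| ≤ ‖f‖ * dist p x₀`; this scale-invariant
bound is what allows cutoffs with unbounded supports and uniformly bounded multiplication
operators. -/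
structure IsMultiplier {X : Type*} [MetricSpace X] (x₀ : X) (C : NNReal) (w : X → ℝ) : Prop where
  abs_le_one : ∀ p, |w p| ≤ 1
  dist_mul_abs_sub_le : ∀ p q, dist p x₀ * |w p - w q| ≤ C * dist p q

namespace IsMultiplier

open LipZero

variable {X : Type*} [MetricSpace X] {x₀ : X} {C D : NNReal} {v w : X → ℝ}

theorem one : IsMultiplier x₀ 0 (1 : X → ℝ) :=
  ⟨by simp, by simp⟩

theorem mul (hv : IsMultiplier x₀ C v) (hw : IsMultiplier x₀ D w) :
    IsMultiplier x₀ (C + D) (v * w) := by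
  refine ⟨fun p => ?_, fun p q => ?_⟩
  · rw [Pi.mul_apply, abs_mul]
    exact mul_le_one₀ (hv.abs_le_one p) (abs_nonneg _) (hw.abs_le_one p)
  · calc dist p x₀ * |v p * w p - v q * w q|
        = dist p x₀ * |(v p - v q) * w p + v q * (w p - w q)| := by ring_nf
      _ ≤ dist p x₀ * (|v p - v q| * 1 + 1 * |w p - w q|) := by
        refine mul_le_mul_of_nonneg_left ((abs_add_le _ _).trans ?_) dist_nonneg
        rw [abs_mul, abs_mul]
        gcongr
        · exact hw.abs_le_one p
        · exact hv.abs_le_one q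
      _ = dist p x₀ * |v p - v q| + dist p x₀ * |w p - w q| := by ring
      _ ≤ C * dist p q + D * dist p q :=
        add_le_add (hv.dist_mul_abs_sub_le p q) (hw.dist_mul_abs_sub_le p q)
      _ = ↑(C + D) * dist p q := by push_cast; ring

theorem prod {ι : Type*} {C : ι → NNReal} {w : ι → X → ℝ} (hw : ∀ i, IsMultiplier x₀ (C i) (w i))
    (s : Finset ι) : IsMultiplier x₀ (∑ i ∈ s, C i) (∏ i ∈ s, w i) := by
  classical
  induction s using Finset.induction_on with
  | empty => simpa only [Finset.sum_empty, Finset.prod_empty] using one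
  | insert i s hi ih =>
    rw [Finset.sum_insert hi, Finset.prod_insert hi]
    exact (hw i).mul ih

theorem lipschitzWith_mul (hw : IsMultiplier x₀ C w) (f : LipZero X x₀) :
    LipschitzWith ((1 + C) * ‖f‖₊) fun p => w p * f p := by
  refine LipschitzWith.of_dist_le_mul fun p q => ?_
  calc |w p * f p - w q * f q| = |w q * (f p - f q) + f p * (w p - w q)| := by ring_nf
    _ ≤ |w q| * |f p - f q| + |f p| * |w p - w q| := by
      rw [← abs_mul, ← abs_mul]
      exact abs_add_le _ _
    _ ≤ 1 * (‖f‖ * dist p q) + ‖f‖ * dist p x₀ * |w p - w q| := by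
      gcongr
      · exact hw.abs_le_one q
      · exact abs_sub_le f p q
      · exact abs_apply_le f p
    _ ≤ 1 * (‖f‖ * dist p q) + ‖f‖ * (C * dist p q) := by
      rw [mul_assoc ‖f‖]
      gcongr _ + ‖f‖ * ?_
      exact hw.dist_mul_abs_sub_le p q
    _ = ↑((1 + C) * ‖f‖₊) * dist p q := by push_cast; ring

/-- The bounded operator `f ↦ w * f` on `Lip₀(X)`. -/
def mulL (hw : IsMultiplier x₀ C w) : LipZero X x₀ →L[ℝ] LipZero X x₀ :=
  LinearMap.mkContinuous
    { toFun := fun f => ofLipschitzWith _ (hw.lipschitzWith_mul f) (by simp)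
      map_add' := fun f g => LipZero.ext fun p => mul_add _ _ _
      map_smul' := fun c f => LipZero.ext fun p => mul_left_comm _ _ _ } (1 + C)
    fun f => norm_ofLipschitzWith_le (hw.lipschitzWith_mul f) (by simp)

@[simp] theorem mulL_apply (hw : IsMultiplier x₀ C w) (f : LipZero X x₀) (p : X) :
    hw.mulL f p = w p * f p := rfl

theorem norm_mulL_apply_le (hw : IsMultiplier x₀ C w) (f : LipZero X x₀) :
    ‖hw.mulL f‖ ≤ (1 + C) * ‖f‖ :=
  norm_ofLipschitzWith_le (hw.lipschitzWith_mul f) (by simp)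

theorem delta_comp_mulL (hw : IsMultiplier x₀ C w) (p : X) :
    (delta x₀ p).comp hw.mulL = w p • delta x₀ p := rfl

end IsMultiplier

namespace LipFree

open LipZero

variable {X : Type*} [MetricSpace X] {x₀ : X} {μ : StrongDual ℝ (LipZero X x₀)}

theorem delta_mem (p : X) : delta x₀ p ∈ LipFree X x₀ :=
  Submodule.le_topologicalClosure _ (Submodule.subset_span ⟨p, rfl⟩)

theorem isClosed : IsClosed (LipFree X x₀ : Set (StrongDual ℝ (LipZero X x₀))) :=
  Submodule.isClosed_topologicalClosure _

theorem le_of_delta_mem {P : Submodule ℝ (StrongDual ℝ (LipZero X x₀))}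
    (hP : IsClosed (P : Set (StrongDual ℝ (LipZero X x₀)))) (h : ∀ p, delta x₀ p ∈ P) :
    LipFree X x₀ ≤ P :=
  Submodule.topologicalClosure_minimal _ (Submodule.span_le.2 (Set.range_subset_iff.2 h)) hP

theorem comp_mem {Y : Type*} [MetricSpace Y] {y₀ : Y} {A : LipZero Y y₀ →L[ℝ] LipZero X x₀}
    (hA : ∀ p, (delta x₀ p).comp A ∈ LipFree Y y₀) (hμ : μ ∈ LipFree X x₀) :
    μ.comp A ∈ LipFree Y y₀ :=
  le_of_delta_mem
    (P := (LipFree Y y₀).comap (ContinuousLinearMap.precomp ℝ A).toLinearMap)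
    (isClosed.preimage (ContinuousLinearMap.precomp ℝ A).continuous) hA hμ

theorem exists_apply_eq (φ : StrongDual ℝ (StrongDual ℝ (LipZero X x₀))) :
    ∃ f : LipZero X x₀, ∀ μ ∈ LipFree X x₀, φ μ = μ f := by
  have hlip : LipschitzWith ‖φ‖₊ fun p => φ (delta x₀ p) :=
    LipschitzWith.of_dist_le_mul fun p q => by
      rw [dist_eq_norm, ← map_sub]
      exact φ.le_opNorm_of_le (norm_delta_sub_delta_le p q)
  let f : LipZero X x₀ := ofLipschitzWith _ hlip (by simp)
  have hker : LipFree X x₀ ≤ (φ - ContinuousLinearMap.apply ℝ ℝ f).ker :=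
    le_of_delta_mem (ContinuousLinearMap.isClosed_ker _) fun p => sub_self (φ (delta x₀ p))
  exact ⟨f, fun μ hμ => sub_eq_zero.1 (hker hμ)⟩

theorem exists_finsupp_approx (hμ : μ ∈ LipFree X x₀) {η : ℝ} (hη : 0 < η) :
    ∃ c : X →₀ ℝ, ∀ f, |μ f - c.sum fun p t => t * f p| ≤ η * ‖f‖ := by
  obtain ⟨ν, hν, hμν⟩ := Metric.mem_closure_iff.1 hμ η hη
  obtain ⟨c, rfl⟩ := Finsupp.mem_span_range_iff_exists_finsupp.1 hν
  refine ⟨c, fun f => ?_⟩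
  have happly : (c.sum fun p t => t • delta x₀ p) f = c.sum fun p t => t * f p :=
    map_finsuppSum (ContinuousLinearMap.apply ℝ ℝ f) c _
  rw [← happly]
  exact (μ - _).le_of_opNorm_le (dist_eq_norm μ _ ▸ hμν.le) f

theorem exists_finset_abs_apply_le (hμ : μ ∈ LipFree X x₀) {η : ℝ} (hη : 0 < η) :
    ∃ F : Finset X, ∀ f, (∀ x ∈ F, f x = 0) → |μ f| ≤ η * ‖f‖ := by
  obtain ⟨c, hc⟩ := exists_finsupp_approx hμ hη
  refine ⟨c.support, fun f hf => ?_⟩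
  have hsum : (c.sum fun p t => t * f p) = 0 :=
    Finset.sum_eq_zero fun p hp => mul_eq_zero_of_right _ (hf p hp)
  simpa only [hsum, sub_zero] using hc f

theorem tendsto_apply_zero (hμ : μ ∈ LipFree X x₀) {ι : Type*} {l : Filter ι}
    {g : ι → LipZero X x₀} {B : ℝ} (hB : ∀ i, ‖g i‖ ≤ B)
    (hg : ∀ p, Tendsto (fun i => g i p) l (𝓝 0)) : Tendsto (fun i => μ (g i)) l (𝓝 0) := by
  refine tendsto_zero_of_forall_exists_norm_sub_le fun ε hε => ?_
  obtain ⟨c, hc⟩ := exists_finsupp_approx hμ (η := ε / (|B| + 1)) (by positivity)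
  refine ⟨fun i => c.sum fun p t => t * g i p, ?_, fun i => (hc (g i)).trans ?_⟩
  · simpa only [Finsupp.sum, mul_zero, Finset.sum_const_zero] using
      tendsto_finsetSum c.support fun p _ => (hg p).const_mul (c p)
  · rw [div_mul_eq_mul_div, div_le_iff₀ (by positivity)]
    gcongr
    exact ((hB i).trans (le_abs_self B)).trans (le_add_of_nonneg_right zero_le_one)

end LipFree

/-- The functional `μ` sees only the values on `S`. -/
def SupportedOn {X : Type*} [MetricSpace X] {x₀ : X} (S : Set X)
    (μ : StrongDual ℝ (LipZero X x₀)) : Prop :=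
  ∀ f : LipZero X x₀, (∀ x ∈ S, f x = 0) → μ f = 0

namespace SupportedOn

open LipZero

variable {X : Type*} [MetricSpace X] {x₀ : X} {S T : Set X} {μ : StrongDual ℝ (LipZero X x₀)}

theorem mono (hST : S ⊆ T) (hμ : SupportedOn S μ) : SupportedOn T μ :=
  fun f hf => hμ f fun x hx => hf x (hST hx)

theorem of_tendsto {ι : Type*} {l : Filter ι} [l.NeBot] {ν : ι → StrongDual ℝ (LipZero X x₀)}
    (hν : Tendsto ν l (𝓝 μ)) (hS : ∀ᶠ i in l, SupportedOn S (ν i)) : SupportedOn S μ :=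
  fun f hf => tendsto_nhds_unique
    (((ContinuousLinearMap.apply ℝ ℝ f).continuous.tendsto μ).comp hν)
    (tendsto_const_nhds.congr' (hS.mono fun _ hi => (hi f hf).symm))

/-- The truncations of `f` at height `ρ → 0` are bounded and converge to `0` pointwise, while `f`
minus its truncation vanishes on a neighbourhood of the zero set of `f`. -/
theorem of_forall_isOpen (hμ : μ ∈ LipFree X x₀)
    (hS : ∀ U, IsOpen U → S ⊆ U → SupportedOn U μ) : SupportedOn S μ := by
  intro f hf
  choose g hgf hgρ hg using fun k : ℕ => f.exists_truncation (ρ := 1 / ((k : ℝ) + 1))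
    (by positivity)
  have hμg : ∀ k, μ (g k) = μ f := fun k => by
    rw [← sub_eq_zero, ← map_sub]
    refine hS {x | |f x| < 1 / ((k : ℝ) + 1)}
      (isOpen_lt f.lipschitzWith_nnnorm.continuous.abs continuous_const) (fun x hx => ?_) _
      fun x hx => ?_
    · rw [Set.mem_ofPred_eq, hf x hx, abs_zero]
      positivity
    · rw [LipZero.sub_apply, hg k x (le_of_lt hx), sub_self]
  have hlim : Tendsto (fun k => μ (g k)) atTop (𝓝 0) :=
    LipFree.tendsto_apply_zero hμ hgf fun p =>
      squeeze_zero_norm (fun k => hgρ k p) tendsto_one_div_add_atTop_nhds_zero_nat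
  simp only [hμg] at hlim
  exact tendsto_nhds_unique tendsto_const_nhds hlim

theorem mem_topologicalClosure_span (hμ : μ ∈ LipFree X x₀) (hS : SupportedOn S μ) :
    μ ∈ (Submodule.span ℝ (delta x₀ '' S)).topologicalClosure := by
  by_contra hμP
  obtain ⟨φ, hφ, hφμ⟩ :=
    exists_dual_eq_zero_of_notMem (Submodule.isClosed_topologicalClosure _) hμP
  obtain ⟨f, hf⟩ := LipFree.exists_apply_eq φ
  refine hφμ ((hf μ hμ).trans (hS f fun x hx => ?_))
  exact (hf _ (LipFree.delta_mem x)).symm.trans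
    (hφ _ (Submodule.le_topologicalClosure _ (Submodule.subset_span ⟨x, hx, rfl⟩)))

end SupportedOn

/-- A weakly null sequence in the free space, viewed in the dual of `Lip₀(X)`. Weak nullity is
tested on Lipschitz functions, which represent all bounded functionals on the free space. -/
structure WeaklyNull {X : Type*} [MetricSpace X] {x₀ : X}
    (μ : ℕ → StrongDual ℝ (LipZero X x₀)) : Prop where
  mem : ∀ n, μ n ∈ LipFree X x₀
  tendsto : ∀ f, Tendsto (fun n => μ n f) atTop (𝓝 0)

theorem schurProperty_lipFree_iff {X : Type*} [MetricSpace X] {x₀ : X} :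
    SchurProperty (LipFree X x₀) ↔
      ∀ μ : ℕ → StrongDual ℝ (LipZero X x₀), WeaklyNull μ → Tendsto μ atTop (𝓝 0) := by
  refine ⟨fun h μ hμ => ?_, fun h v hv => ?_⟩
  · refine tendsto_subtype_rng.1 (h (fun n => ⟨μ n, hμ.mem n⟩) fun φ => ?_)
    obtain ⟨Φ, hΦ, -⟩ := exists_extension_norm_eq (LipFree X x₀) φ
    obtain ⟨f, hf⟩ := LipFree.exists_apply_eq Φ
    exact (hμ.tendsto f).congr fun n => by rw [← hf _ (hμ.mem n), ← hΦ ⟨μ n, hμ.mem n⟩]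
  · exact tendsto_subtype_rng.2 (h (fun n => v n) ⟨fun n => (v n).2, fun f =>
      hv ((ContinuousLinearMap.apply ℝ ℝ f).comp (LipFree X x₀).subtypeL)⟩)

section GlidingHump

open LipZero

variable {X : Type*} [MetricSpace X] {x₀ : X}

/-- `G` is the sum of all the humps `g i`. At stage `k` the earlier ones contribute little because
of `hψ`, the later ones because they vanish on `F k`. -/
theorem exists_forall_abs_apply_le_of_pairwise_disjoint {ψ : ℕ → StrongDual ℝ (LipZero X x₀)}
    {g : ℕ → LipZero X x₀} {F : ℕ → Set X} {L η : ℝ} (hη : 0 ≤ η) (hL : ∀ i, ‖g i‖ ≤ L)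
    (hg : ∀ i j, i ≠ j → ∀ p, g i p = 0 ∨ g j p = 0)
    (hψ : ∀ i k, i < k → |ψ k (g i)| ≤ η * (1 / 2) ^ i)
    (hF : ∀ k f, (∀ x ∈ F k, f x = 0) → |ψ k f| ≤ η * ‖f‖)
    (hgF : ∀ k j, k < j → ∀ x ∈ F k, g j x = 0) :
    ∃ G : LipZero X x₀, ∀ k, |ψ k (g k)| ≤ |ψ k G| + η * (2 + 4 * L) := by
  obtain ⟨G, hG, hGL⟩ := exists_finsum_of_pairwise_disjoint hL hg
  refine ⟨G, fun k => ?_⟩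
  have hearlier : |ψ k (∑ i ∈ Finset.range k, g i)| ≤ η * 2 := by
    rw [map_sum]
    calc |∑ i ∈ Finset.range k, ψ k (g i)| ≤ ∑ i ∈ Finset.range k, η * (1 / 2) ^ i :=
          (Finset.abs_sum_le_sum_abs _ _).trans
            (Finset.sum_le_sum fun i hi => hψ i k (Finset.mem_range.1 hi))
      _ ≤ η * 2 := by
        rw [← Finset.mul_sum]
        exact mul_le_mul_of_nonneg_left (sum_geometric_two_le k) hη
  have hlater : |ψ k (G - ∑ i ∈ Finset.range (k + 1), g i)| ≤ η * (4 * L) := by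
    refine (hF k _ fun x hx => ?_).trans (mul_le_mul_of_nonneg_left ?_ hη)
    · rw [LipZero.sub_apply, hG, LipZero.sum_apply, sub_eq_zero]
      refine finsum_eq_finsetSum_of_support_subset _ fun j hj => ?_
      by_contra hjk
      exact hj (hgF k j (by simpa using hjk) x hx)
    · have hpartial := norm_sum_le_of_pairwise_disjoint (s := Finset.range (k + 1))
        Finset.nonempty_range_add_one (fun i _ => hL i) fun i _ j _ => hg i j
      linarith [norm_sub_le G (∑ i ∈ Finset.range (k + 1), g i)]
  have hsplit : ψ k (g k) = ψ k G - ψ k (G - ∑ i ∈ Finset.range (k + 1), g i)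
      - ψ k (∑ i ∈ Finset.range k, g i) := by
    rw [Finset.sum_range_succ, map_sub, map_add]
    ring
  rw [hsplit]
  linarith [abs_sub (ψ k G - ψ k (G - ∑ i ∈ Finset.range (k + 1), g i))
    (ψ k (∑ i ∈ Finset.range k, g i)), abs_sub (ψ k G) (ψ k (G - ∑ i ∈ Finset.range (k + 1), g i))]

theorem IsMultiplier.exists_hump {C : NNReal} {w : X → ℝ} (hw : IsMultiplier x₀ C w)
    {S : Set X} {F : Finset X} {ψ : StrongDual ℝ (LipZero X x₀)} {ε η : ℝ}
    (hη : 0 ≤ η) (hF : ∀ f, (∀ x ∈ F, f x = 0) → |ψ f| ≤ η * ‖f‖) (hwF : ∀ x ∈ F, w x = 1)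
    {f : LipZero X x₀} (hfS : ∀ x ∈ S, f x = 0) (hf : ε * ‖f‖ < |ψ f|) :
    ∃ g : LipZero X x₀, ‖g‖ ≤ 1 + C ∧ (∀ x ∈ S, g x = 0) ∧ (∀ x, w x = 0 → g x = 0) ∧
      ε - η * (2 + C) ≤ |ψ g| := by
  have hf₀ : 0 < ‖f‖ := norm_pos_iff.2 fun h => by simp [h] at hf
  set e : LipZero X x₀ := ‖f‖⁻¹ • f with he
  have he₁ : ‖e‖ = 1 := by rw [he, norm_smul, norm_inv, norm_norm, inv_mul_cancel₀ hf₀.ne']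
  have hψe : ε ≤ |ψ e| := by
    rw [he, map_smul, smul_eq_mul, abs_mul, abs_inv, abs_norm, ← div_eq_inv_mul,
      le_div_iff₀ hf₀]
    exact hf.le
  have hnorm : ‖hw.mulL e‖ ≤ 1 + C := by simpa only [he₁, mul_one] using hw.norm_mulL_apply_le e
  refine ⟨hw.mulL e, hnorm, fun x hx => ?_, fun x hx => ?_, ?_⟩
  · rw [IsMultiplier.mulL_apply, he, LipZero.smul_apply, hfS x hx, mul_zero, mul_zero]
  · rw [IsMultiplier.mulL_apply, hx, zero_mul]
  · have hrest : |ψ (e - hw.mulL e)| ≤ η * (2 + C) := by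
      refine (hF _ fun x hx => ?_).trans (mul_le_mul_of_nonneg_left ?_ hη)
      · rw [LipZero.sub_apply, IsMultiplier.mulL_apply, hwF x hx, one_mul, sub_self]
      · linarith [norm_sub_le e (hw.mulL e)]
    rw [map_sub] at hrest
    linarith [abs_sub_abs_le_abs_sub (ψ e) (ψ (hw.mulL e))]

/-- A family of weights `w E`, indexed by the finite sets `E`, which are `1` on `E` and `0` off an
enlargement `S E` of `E`, with uniformly bounded multiplication operators. -/
structure CutoffFamily (x₀ : X) (C : NNReal) (S : Finset X → Set X) (w : Finset X → X → ℝ) :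
    Prop where
  monotone : Monotone S
  isMultiplier : ∀ E, IsMultiplier x₀ C (w E)
  eq_one : ∀ E, ∀ x ∈ E, w E x = 1
  eq_zero : ∀ E, ∀ x ∉ S E, w E x = 0

variable {C : NNReal} {S : Finset X → Set X} {w : Finset X → X → ℝ} {ε η : ℝ}
  {μ : ℕ → StrongDual ℝ (LipZero X x₀)} {F : ℕ → Finset X}

theorem CutoffFamily.mem_of_mem (hw : CutoffFamily x₀ C S w) {E : Finset X} {x : X} (hx : x ∈ E) :
    x ∈ S E := by
  by_contra hxS
  exact one_ne_zero ((hw.eq_one E x hx).symm.trans (hw.eq_zero E x hxS))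

theorem CutoffFamily.exists_hump (hw : CutoffFamily x₀ C S w) (hη : 0 ≤ η) (hηε : η ≤ ε)
    (hF : ∀ n f, (∀ x ∈ F n, f x = 0) → |μ n f| ≤ η * ‖f‖)
    (hlarge : ∀ E, ∃ n f, (∀ x ∈ S E, f x = 0) ∧ ε * ‖f‖ < |μ n f|) (N : ℕ) :
    ∃ n g, N ≤ n ∧ (∀ m < N, ∀ x ∈ S (F m), g x = 0) ∧
      ‖g‖ ≤ 1 + C ∧ (∀ x ∉ S (F n), g x = 0) ∧ ε - η * (2 + C) ≤ |μ n g| := by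
  classical
  obtain ⟨n, f, hfS, hf⟩ := hlarge ((Finset.range N).biUnion F)
  have hsub : ∀ m < N, F m ⊆ (Finset.range N).biUnion F := fun m hm =>
    Finset.subset_biUnion_of_mem F (Finset.mem_range.2 hm)
  have hNn : N ≤ n := by
    by_contra! hn
    have hsmall := hF n f fun x hx => hfS x (hw.mem_of_mem (hsub n hn hx))
    exact hf.not_ge (hsmall.trans (by gcongr))
  obtain ⟨g, hgL, hgS, hgw, hg⟩ := (hw.isMultiplier (F n)).exists_hump hη (hF n) (hw.eq_one (F n))
    hfS hf
  exact ⟨n, g, hNn, fun m hm x hx => hgS x (hw.monotone (hsub m hm) hx), hgL,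
    fun x hx => hgw x (hw.eq_zero _ x hx), hg⟩

theorem exists_seq_humps (hμ : ∀ f, Tendsto (fun n => μ n f) atTop (𝓝 0)) (hη : 0 < η)
    {T : ℕ → Set X} {Q : ℕ → LipZero X x₀ → Prop}
    (hhump : ∀ N, ∃ n g, N ≤ n ∧ (∀ m < N, ∀ x ∈ T m, g x = 0) ∧ Q n g) :
    ∃ (n : ℕ → ℕ) (g : ℕ → LipZero X x₀), StrictMono n ∧ (∀ k, Q (n k) (g k)) ∧
      (∀ i k, i < k → ∀ x ∈ T (n i), g k x = 0) ∧
      ∀ i k, i < k → |μ (n k) (g i)| ≤ η * (1 / 2) ^ i := by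
  obtain ⟨y, hy, hlt⟩ := exists_seq_of_forall_finset_exists
    (fun y : ℕ × LipZero X x₀ => Q y.1 y.2)
    (fun y z => y.1 < z.1 ∧ (∀ x ∈ T y.1, z.2 x = 0) ∧ |μ z.1 y.2| ≤ η * (1 / 2) ^ y.1)
    fun s _ => by
      have hsmall : ∀ᶠ n in atTop, ∀ y ∈ s, y.1 < n ∧ |μ n y.2| ≤ η * (1 / 2) ^ y.1 :=
        (eventually_all_finset s).2 fun y _ => (eventually_gt_atTop y.1).and <|
          ((hμ y.2).norm.eventually_lt_const (by rw [norm_zero]; positivity)).mono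
            fun n hn => le_of_lt hn
      obtain ⟨N, hN⟩ := eventually_atTop.1 hsmall
      obtain ⟨n, g, hn, hg, hQ⟩ := hhump N
      exact ⟨(n, g), hQ, fun y hy =>
        ⟨(hN n hn y hy).1, hg y.1 (hN N le_rfl y hy).1, (hN n hn y hy).2⟩⟩
  have hn : StrictMono fun k => (y k).1 := fun i k hik => (hlt i k hik).1
  refine ⟨_, fun k => (y k).2, hn, hy, fun i k hik => (hlt i k hik).2.1,
    fun i k hik => (hlt i k hik).2.2.trans ?_⟩
  exact mul_le_mul_of_nonneg_left
    (pow_le_pow_of_le_one (by norm_num) (by norm_num) (hn.id_le i)) hη.le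

theorem WeaklyNull.gliding_hump (hμ : WeaklyNull μ) (hw : CutoffFamily x₀ C S w) (hε : 0 < ε) :
    ∃ E : Finset X, ∀ n f, (∀ x ∈ S E, f x = 0) → |μ n f| ≤ ε * ‖f‖ := by
  by_contra! hlarge
  obtain ⟨η, hη, hηε⟩ : ∃ η : ℝ, 0 < η ∧ η * (8 + 5 * C) = ε / 2 :=
    ⟨ε / 2 / (8 + 5 * C), by positivity, div_mul_cancel₀ _ (by positivity)⟩
  have hηC : 0 ≤ η * C := by positivity
  choose F hF using fun n => LipFree.exists_finset_abs_apply_le (hμ.mem n) hη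
  obtain ⟨n, g, hn, hg, hgS, hearlier⟩ := exists_seq_humps hμ.tendsto hη
    (hw.exists_hump hη.le (by linarith) hF hlarge)
  choose hgL hgF hglarge using hg
  have hdisj : ∀ i j, i < j → ∀ p, g i p = 0 ∨ g j p = 0 := fun i j hij p =>
    (em (p ∈ S (F (n i)))).symm.imp (hgF i p) (hgS i j hij p)
  obtain ⟨G, hG⟩ := exists_forall_abs_apply_le_of_pairwise_disjoint (ψ := fun k => μ (n k))
    (F := fun k => F (n k)) hη.le hgL
    (fun i j hij p => hij.lt_or_gt.elim (fun h => hdisj i j h p) fun h => (hdisj j i h p).symm)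
    hearlier (fun k => hF (n k)) fun k j hkj x hx => hgS k j hkj x (hw.mem_of_mem hx)
  obtain ⟨k, hk⟩ := (((hμ.tendsto G).comp hn.tendsto_atTop).norm.eventually_lt_const
    (by rw [norm_zero]; exact half_pos hε)).exists
  change |μ (n k) G| < ε / 2 at hk
  linarith [hglarge k, hG k]

end GlidingHump

section Cutoff

variable {X : Type*} [MetricSpace X] {x₀ p q x : X} {E : Set X}

/-- The distance of `x` to `E ∪ {x₀}`, relative to `1 + dist x x₀`. Its sublevel sets are
neighbourhoods of `E` whose width grows linearly at infinity, so that their indicator functions can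
be smoothed to weights with multiplication operators bounded independently of `E`. -/
def relInfDist (x₀ : X) (E : Set X) (x : X) : ℝ :=
  Metric.infDist x (insert x₀ E) / (1 + dist x x₀)

theorem relInfDist_nonneg : 0 ≤ relInfDist x₀ E x :=
  div_nonneg Metric.infDist_nonneg (by positivity)

theorem relInfDist_le_one : relInfDist x₀ E x ≤ 1 :=
  div_le_one_of_le₀ ((Metric.infDist_le_dist_of_mem (Set.mem_insert x₀ E)).trans
    (le_add_of_nonneg_left zero_le_one)) (by positivity)

theorem relInfDist_eq_zero (hx : x ∈ insert x₀ E) : relInfDist x₀ E x = 0 := by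
  rw [relInfDist, Metric.infDist_zero_of_mem hx, zero_div]

theorem relInfDist_mul (x₀ : X) (E : Set X) (x : X) :
    relInfDist x₀ E x * (1 + dist x x₀) = Metric.infDist x (insert x₀ E) :=
  div_mul_cancel₀ _ (by positivity)

theorem relInfDist_anti : Antitone (relInfDist x₀) := fun _ _ hEF _ =>
  div_le_div_of_nonneg_right (Metric.infDist_le_infDist_of_subset (Set.insert_subset_insert hEF)
    (Set.insert_nonempty _ _)) (by positivity)

theorem continuous_relInfDist : Continuous (relInfDist x₀ E) :=
  (Metric.continuous_infDist_pt _).div (by fun_prop) fun _ => by positivity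

theorem dist_mul_abs_relInfDist_sub_le :
    dist p x₀ * |relInfDist x₀ E p - relInfDist x₀ E q| ≤ 2 * dist p q := by
  have hp : (0 : ℝ) < 1 + dist p x₀ := by positivity
  have hsplit : (1 + dist p x₀) * (relInfDist x₀ E p - relInfDist x₀ E q) =
      (Metric.infDist p (insert x₀ E) - Metric.infDist q (insert x₀ E)) +
        relInfDist x₀ E q * (dist q x₀ - dist p x₀) := by
    rw [← relInfDist_mul x₀ E p, ← relInfDist_mul x₀ E q]
    ring
  calc dist p x₀ * |relInfDist x₀ E p - relInfDist x₀ E q|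
      ≤ |(1 + dist p x₀) * (relInfDist x₀ E p - relInfDist x₀ E q)| := by
        rw [abs_mul, abs_of_pos hp]
        gcongr
        exact le_add_of_nonneg_left zero_le_one
    _ ≤ |Metric.infDist p (insert x₀ E) - Metric.infDist q (insert x₀ E)| +
        relInfDist x₀ E q * |dist q x₀ - dist p x₀| := by
        rw [hsplit, ← abs_of_nonneg (relInfDist_nonneg (x := q)), ← abs_mul,
          abs_of_nonneg relInfDist_nonneg]
        exact abs_add_le _ _
    _ ≤ dist p q + 1 * dist p q := by
        gcongr
        · exact (Metric.lipschitz_infDist_pt (insert x₀ E)).dist_le_mul p q |>.trans_eq (one_mul _)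
        · exact relInfDist_le_one
        · exact (abs_dist_sub_le q p x₀).trans_eq (dist_comm q p)
    _ = 2 * dist p q := by ring

theorem dist_le_of_relInfDist_le_half {R : ℝ} (hE : ∀ y ∈ insert x₀ E, dist y x₀ ≤ R)
    (hx : relInfDist x₀ E x ≤ 1 / 2) : dist x x₀ ≤ 2 * R + 1 := by
  have hinf : dist x x₀ - R ≤ Metric.infDist x (insert x₀ E) :=
    (Metric.le_infDist (Set.insert_nonempty _ _)).2 fun y hy => by
      linarith [dist_triangle x y x₀, hE y hy]
  rw [← relInfDist_mul] at hinf
  nlinarith [dist_nonneg (x := x) (y := x₀)]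

/-- Once some `r i` is at most `1 / 2`, the set is bounded; on a bounded set, a small relative
distance to `E i` is a small distance. -/
theorem exists_finite_cover_of_relInfDist_le (x₀ : X) (E : ℕ → Finset X) {r : ℕ → ℝ}
    (hr : Tendsto r atTop (𝓝 0)) {η : ℝ} (hη : 0 < η) :
    ∃ k, ∃ t : Set X, t.Finite ∧
      {x | ∀ i < k, relInfDist x₀ (E i) x ≤ r i} ⊆ ⋃ y ∈ t, Metric.ball y η := by
  obtain ⟨i, hi⟩ := (hr.eventually_le_const one_half_pos).exists
  have hfin : ∀ i, (insert x₀ (E i : Set X)).Finite := fun i => (E i).finite_toSet.insert x₀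
  obtain ⟨R, hR⟩ := (hfin i).isBounded.subset_closedBall x₀
  obtain ⟨j, hj⟩ := ((hr.mul_const (2 + 2 * R)).eventually_lt_const
    (by rwa [zero_mul])).exists
  refine ⟨max i j + 1, insert x₀ (E j), hfin j, fun x hx => ?_⟩
  have hxR : dist x x₀ ≤ 2 * R + 1 :=
    dist_le_of_relInfDist_le_half hR ((hx i (by omega)).trans hi)
  have hxj : Metric.infDist x (insert x₀ (E j : Set X)) < η := by
    rw [← relInfDist_mul]
    calc relInfDist x₀ (E j) x * (1 + dist x x₀) ≤ relInfDist x₀ (E j) x * (2 + 2 * R) :=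
          mul_le_mul_of_nonneg_left (by linarith) relInfDist_nonneg
      _ ≤ r j * (2 + 2 * R) :=
          mul_le_mul_of_nonneg_right (hx j (by omega))
            (by linarith [dist_nonneg (x := x) (y := x₀)])
      _ < η := hj
  obtain ⟨y, hy, hxy⟩ := (Metric.infDist_lt_iff (Set.insert_nonempty _ _)).1 hxj
  exact Set.mem_biUnion hy hxy

/-- The weight which is `1` where `relInfDist x₀ E ≤ δ`, is `0` where `2 * δ ≤ relInfDist x₀ E`, and
interpolates linearly in between; for `δ = 0` division by zero makes it constantly `1`. -/
def relCutoff (x₀ : X) (E : Set X) (δ : NNReal) (x : X) : ℝ :=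
  max 0 (min 1 (2 - relInfDist x₀ E x / δ))

variable {δ : NNReal}

theorem relCutoff_eq_one (hx : relInfDist x₀ E x ≤ δ) : relCutoff x₀ E δ x = 1 := by
  have : relInfDist x₀ E x / δ ≤ 1 := div_le_one_of_le₀ hx δ.2
  rw [relCutoff, min_eq_left (by linarith), max_eq_right zero_le_one]

theorem relCutoff_eq_zero (hδ : 0 < δ) (hx : 2 * δ ≤ relInfDist x₀ E x) :
    relCutoff x₀ E δ x = 0 := by
  have : 2 ≤ relInfDist x₀ E x / δ := (le_div_iff₀ (NNReal.coe_pos.2 hδ)).2 hx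
  exact max_eq_left (min_le_of_right_le (by linarith))

theorem isMultiplier_relCutoff (x₀ : X) (E : Set X) (δ : NNReal) :
    IsMultiplier x₀ (2 / δ) (relCutoff x₀ E δ) where
  abs_le_one p := abs_le.2 ⟨neg_one_lt_zero.le.trans (le_max_left _ _),
    max_le zero_le_one (min_le_left _ _)⟩
  dist_mul_abs_sub_le p q := by
    have hclamp : |relCutoff x₀ E δ p - relCutoff x₀ E δ q| ≤
        |relInfDist x₀ E p - relInfDist x₀ E q| / δ := by
      have hlip : LipschitzWith 1 fun t : ℝ => max 0 (min 1 (2 - t)) :=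
        ((IsometryEquiv.subLeft (2 : ℝ)).isometry.lipschitz.const_min 1).const_max 0
      refine (hlip.dist_le_mul (relInfDist x₀ E p / δ) (relInfDist x₀ E q / δ)).trans_eq ?_
      rw [NNReal.coe_one, one_mul, Real.dist_eq, ← sub_div, abs_div, NNReal.abs_eq]
    calc dist p x₀ * |relCutoff x₀ E δ p - relCutoff x₀ E δ q|
        ≤ dist p x₀ * (|relInfDist x₀ E p - relInfDist x₀ E q| / δ) := by gcongr
      _ = dist p x₀ * |relInfDist x₀ E p - relInfDist x₀ E q| / δ := (mul_div_assoc _ _ _).symm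
      _ ≤ 2 * dist p q / δ := by gcongr ?_ / _; exact dist_mul_abs_relInfDist_sub_le
      _ = ↑(2 / δ) * dist p q := by push_cast; ring

theorem cutoffFamily_relCutoff (x₀ : X) (hδ : 0 < δ) :
    CutoffFamily x₀ (2 / δ) (fun E => {x | relInfDist x₀ E x < 2 * δ})
      fun E => relCutoff x₀ E δ where
  monotone _ _ hEF x hx := (relInfDist_anti (Finset.coe_subset.2 hEF) x).trans_lt hx
  isMultiplier E := isMultiplier_relCutoff x₀ E δ
  eq_one _ _ hx := relCutoff_eq_one
    ((relInfDist_eq_zero (Set.mem_insert_of_mem _ hx)).trans_le δ.2)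
  eq_zero _ _ hx := relCutoff_eq_zero hδ (not_lt.1 hx)

theorem WeaklyNull.exists_finset_abs_apply_le {μ : ℕ → StrongDual ℝ (LipZero X x₀)}
    (hμ : WeaklyNull μ) (hδ : 0 < δ) {ε : ℝ} (hε : 0 < ε) : ∃ E : Finset X, ∀ n f,
      (∀ x, relInfDist x₀ E x ≤ δ → f x = 0) → |μ n f| ≤ ε * ‖f‖ := by
  obtain ⟨E, hE⟩ := hμ.gliding_hump (cutoffFamily_relCutoff x₀ (half_pos hδ)) hε
  refine ⟨E, fun n f hf => hE n f fun x hx => hf x (le_of_lt (lt_of_lt_of_eq hx ?_))⟩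
  push_cast
  ring

end Cutoff

section Compact

open LipZero

theorem exists_mem_iInter_ultrafilter_le_nhds {X : Type*} [PseudoMetricSpace X] [CompleteSpace X]
    {S : ℕ → Set X} (hS : ∀ k, IsClosed (S k))
    (hcover : ∀ η > 0, ∃ k, ∃ t : Set X, t.Finite ∧ S k ⊆ ⋃ y ∈ t, Metric.ball y η)
    {u : Ultrafilter X} (hu : ∀ k, S k ∈ u) : ∃ x ∈ ⋂ k, S k, (u : Filter X) ≤ 𝓝 x := by
  have hcauchy : Cauchy (u : Filter X) := by
    refine Metric.cauchy_iff.2 ⟨u.neBot, fun ε hε => ?_⟩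
    obtain ⟨k, t, ht, hkt⟩ := hcover (ε / 2) (half_pos hε)
    obtain ⟨y, -, hy⟩ := (Ultrafilter.finite_biUnion_mem_iff ht).1 (mem_of_superset (hu k) hkt)
    refine ⟨_, hy, fun p hp q hq => ?_⟩
    linarith [dist_triangle_right p q y, Metric.mem_ball.1 hp, Metric.mem_ball.1 hq]
  obtain ⟨x, hx⟩ := CompleteSpace.complete hcauchy
  exact ⟨x, Set.mem_iInter.2 fun k =>
    isClosed_iff_ultrafilter.1 (hS k) x u hx (hu k), hx⟩

theorem isCompact_iInter_of_finite_cover {X : Type*} [PseudoMetricSpace X] [CompleteSpace X]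
    {S : ℕ → Set X} (hS : ∀ k, IsClosed (S k))
    (hcover : ∀ η > 0, ∃ k, ∃ t : Set X, t.Finite ∧ S k ⊆ ⋃ y ∈ t, Metric.ball y η) :
    IsCompact (⋂ k, S k) :=
  isCompact_iff_ultrafilter_le_nhds.2 fun _ hu =>
    exists_mem_iInter_ultrafilter_le_nhds hS hcover fun k =>
      mem_of_superset (le_principal_iff.1 hu) (Set.iInter_subset S k)

theorem exists_subset_of_iInter_subset {X : Type*} [PseudoMetricSpace X] [CompleteSpace X]
    {S : ℕ → Set X} (hS : ∀ k, IsClosed (S k)) (hanti : Antitone S)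
    (hcover : ∀ η > 0, ∃ k, ∃ t : Set X, t.Finite ∧ S k ⊆ ⋃ y ∈ t, Metric.ball y η)
    {U : Set X} (hU : IsOpen U) (hSU : ⋂ k, S k ⊆ U) : ∃ k, S k ⊆ U := by
  by_contra! hno
  choose x hxS hxU using fun k => Set.not_subset.1 (hno k)
  have hle : (Ultrafilter.of (map x atTop) : Filter X) ≤ map x atTop := Ultrafilter.of_le _
  obtain ⟨y, hy, hlim⟩ := exists_mem_iInter_ultrafilter_le_nhds hS hcover
    (u := Ultrafilter.of (map x atTop)) fun k =>
      hle ((eventually_ge_atTop k).mono fun i hi => hanti hi (hxS i))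
  exact Ultrafilter.compl_mem_iff_notMem.1
    (hle (mem_map.2 (Eventually.of_forall hxU))) (hlim (hU.mem_nhds (hSU hy)))

variable {X : Type*} [MetricSpace X] {x₀ : X} {C : NNReal} {w : X → ℝ}
  {μ : ℕ → StrongDual ℝ (LipZero X x₀)} {ε : ℝ}

theorem SupportedOn.comp_mulL (hw : IsMultiplier x₀ C w) (ψ : StrongDual ℝ (LipZero X x₀)) :
    SupportedOn {x | w x ≠ 0} (ψ.comp hw.mulL) := fun f hf => by
  have hzero : hw.mulL f = 0 := LipZero.ext fun p => mul_eq_zero.2 (or_iff_not_imp_left.2 (hf p))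
  rw [ContinuousLinearMap.comp_apply, hzero, map_zero]

theorem WeaklyNull.comp_mulL (hμ : WeaklyNull μ) (hw : IsMultiplier x₀ C w) :
    WeaklyNull fun n => (μ n).comp hw.mulL where
  mem n := LipFree.comp_mem (fun p => by
    rw [hw.delta_comp_mulL]
    exact Submodule.smul_mem _ _ (LipFree.delta_mem p)) (hμ.mem n)
  tendsto f := hμ.tendsto (hw.mulL f)

theorem WeaklyNull.of_forall_exists_norm_sub_le
    (h : ∀ ε > 0, ∃ ν : ℕ → StrongDual ℝ (LipZero X x₀), WeaklyNull ν ∧ ∀ n, ‖μ n - ν n‖ ≤ ε) :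
    WeaklyNull μ where
  mem n := LipFree.isClosed.closure_eq.subset <| Metric.mem_closure_iff.2 fun ε hε => by
    obtain ⟨ν, hν, hμν⟩ := h (ε / 2) (half_pos hε)
    exact ⟨ν n, hν.mem n, (dist_eq_norm (μ n) (ν n)).trans_lt ((hμν n).trans_lt (half_lt_self hε))⟩
  tendsto f := tendsto_zero_of_forall_exists_norm_sub_le fun ε hε => by
    obtain ⟨ν, hν, hμν⟩ := h (ε / (‖f‖ + 1)) (by positivity)
    refine ⟨fun n => ν n f, hν.tendsto f, fun n => ?_⟩
    refine ((μ n - ν n).le_of_opNorm_le (hμν n) f).trans ?_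
    rw [div_mul_eq_mul_div, div_le_iff₀ (by positivity)]
    gcongr
    exact le_add_of_nonneg_right zero_le_one

theorem norm_comp_mulL_sub_comp_mulL_mul_le {D : NNReal} {v : X → ℝ} (hv : IsMultiplier x₀ C v)
    (hw : IsMultiplier x₀ D w) {ψ : StrongDual ℝ (LipZero X x₀)} (hε : 0 ≤ ε)
    (hψ : ∀ f, (∀ x, w x = 1 → f x = 0) → |ψ f| ≤ ε * ‖f‖) :
    ‖ψ.comp hv.mulL - ψ.comp (hv.mul hw).mulL‖ ≤ ε * (2 * (1 + (C + D))) := by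
  refine ContinuousLinearMap.opNorm_le_bound _ (by positivity) fun f => ?_
  have hvanish : ∀ x, w x = 1 → (hv.mulL f - (hv.mul hw).mulL f) x = 0 := fun x hx => by
    simp [hx]
  have hnorm : ‖hv.mulL f - (hv.mul hw).mulL f‖ ≤ 2 * (1 + (C + D)) * ‖f‖ := by
    have h₁ := hv.norm_mulL_apply_le f
    have h₂ := (hv.mul hw).norm_mulL_apply_le f
    have hD : 0 ≤ (D : ℝ) * ‖f‖ := by positivity
    push_cast at h₂
    linarith [norm_sub_le (hv.mulL f) ((hv.mul hw).mulL f)]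
  calc ‖(ψ.comp hv.mulL - ψ.comp (hv.mul hw).mulL) f‖
      = |ψ (hv.mulL f - (hv.mul hw).mulL f)| := by rw [map_sub]; rfl
    _ ≤ ε * (2 * (1 + (C + D)) * ‖f‖) := (hψ _ hvanish).trans (by gcongr)
    _ = ε * (2 * (1 + (C + D))) * ‖f‖ := (mul_assoc _ _ _).symm

/-- `ν n` is the limit of the functionals `f ↦ μ n (w 0 * ⋯ * w (k - 1) * f)`. -/
theorem WeaklyNull.exists_supportedOn_ne_zero (hμ : WeaklyNull μ) {C : ℕ → NNReal}
    {w : ℕ → X → ℝ} (hw : ∀ i, IsMultiplier x₀ (C i) (w i)) (hε : 0 < ε)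
    (hsmall : ∀ k n f, (∀ x, w k x = 1 → f x = 0) →
      |μ n f| ≤ ε / 2 / 2 ^ k / (2 * (1 + ∑ i ∈ Finset.range (k + 1), (C i : ℝ))) * ‖f‖) :
    ∃ ν : ℕ → StrongDual ℝ (LipZero X x₀), WeaklyNull ν ∧ (∀ n, ‖μ n - ν n‖ ≤ ε) ∧
      ∀ n k, SupportedOn {x | ∀ i < k, w i x ≠ 0} (ν n) := by
  have hprod : ∀ k, IsMultiplier x₀ (∑ i ∈ Finset.range k, C i) (∏ i ∈ Finset.range k, w i) :=
    fun k => IsMultiplier.prod hw _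
  set ν' : ℕ → ℕ → StrongDual ℝ (LipZero X x₀) := fun n k => (μ n).comp (hprod k).mulL
  have hstep : ∀ n k, dist (ν' n k) (ν' n (k + 1)) ≤ ε / 2 / 2 ^ k := fun n k => by
    have hsucc : ν' n (k + 1) = (μ n).comp ((hprod k).mul (hw k)).mulL := by
      ext f
      exact congrArg (μ n) (LipZero.ext fun p => by simp [Finset.prod_range_succ])
    rw [dist_eq_norm, hsucc]
    refine (norm_comp_mulL_sub_comp_mulL_mul_le (hprod k) (hw k) (by positivity)
      (hsmall k n)).trans_eq ?_
    rw [Finset.sum_range_succ]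
    push_cast
    exact div_mul_cancel₀ _ (by positivity)
  choose ν hν using fun n => cauchySeq_tendsto_of_complete
    (cauchySeq_of_le_geometric_two (hstep n))
  have hdist : ∀ n k, ‖ν n - ν' n k‖ ≤ ε / 2 ^ k := fun n k => by
    rw [← dist_eq_norm, dist_comm]
    exact dist_le_of_le_geometric_two_of_tendsto (hstep n) (hν n) k
  have hzero : ∀ n, ν' n 0 = μ n := fun n => by
    ext f
    exact congrArg (μ n) (LipZero.ext fun p => by simp)
  refine ⟨ν, WeaklyNull.of_forall_exists_norm_sub_le fun δ hδ => ?_, fun n => ?_, fun n k => ?_⟩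
  · obtain ⟨k, hk⟩ := exists_pow_lt_of_lt_one (div_pos hδ hε) (one_half_lt_one (α := ℝ))
    refine ⟨fun n => ν' n k, hμ.comp_mulL (hprod k), fun n => (hdist n k).trans ?_⟩
    rw [lt_div_iff₀ hε] at hk
    simpa [div_eq_inv_mul] using hk.le
  · simpa [hzero, norm_sub_rev] using hdist n 0
  · refine SupportedOn.of_tendsto (hν n) ((eventually_ge_atTop k).mono fun j hj => ?_)
    refine (SupportedOn.comp_mulL (hprod j) (μ n)).mono
      fun x (hx : (∏ i ∈ Finset.range j, w i) x ≠ 0) i hi hix => hx ?_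
    rw [Finset.prod_apply]
    exact Finset.prod_eq_zero (Finset.mem_range.2 (hi.trans_le hj)) hix

theorem WeaklyNull.exists_compact [CompleteSpace X] (hμ : WeaklyNull μ) (hε : 0 < ε) :
    ∃ (ν : ℕ → StrongDual ℝ (LipZero X x₀)) (K : Set X), WeaklyNull ν ∧ (∀ n, ‖μ n - ν n‖ ≤ ε) ∧
      IsCompact K ∧ x₀ ∈ K ∧ ∀ n, SupportedOn K (ν n) := by
  obtain ⟨δ, -, hδ, hδ₀⟩ := exists_seq_strictAnti_tendsto (0 : NNReal)
  choose E hE using fun k => hμ.exists_finset_abs_apply_le (hδ k)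
    (show 0 < ε / 2 / 2 ^ k / (2 * (1 + ∑ i ∈ Finset.range (k + 1), ((2 / δ i : NNReal) : ℝ))) by
      positivity)
  obtain ⟨ν, hν, hμν, hsupp⟩ := hμ.exists_supportedOn_ne_zero
    (fun i => isMultiplier_relCutoff x₀ (E i) (δ i)) hε
    fun k n f hf => hE k n f fun x hx => hf x (relCutoff_eq_one hx)
  set S : ℕ → Set X := fun k => {x | ∀ i < k, relInfDist x₀ (E i) x ≤ 2 * δ i} with hS
  have hclosed : ∀ k, IsClosed (S k) := fun k => by
    simp only [hS, Set.ofPred_forall]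
    exact isClosed_biInter fun i _ => isClosed_le continuous_relInfDist continuous_const
  have hanti : Antitone S := fun j k hjk x hx i hi => hx i (hi.trans_le hjk)
  have hlim : Tendsto (fun i => 2 * (δ i : ℝ)) atTop (𝓝 0) := by
    simpa using (NNReal.tendsto_coe.2 hδ₀).const_mul 2
  have hcover : ∀ η > 0, ∃ k, ∃ t : Set X, t.Finite ∧ S k ⊆ ⋃ y ∈ t, Metric.ball y η :=
    fun η hη => exists_finite_cover_of_relInfDist_le x₀ E hlim hη
  refine ⟨ν, ⋂ k, S k, hν, hμν, isCompact_iInter_of_finite_cover hclosed hcover,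
    Set.mem_iInter.2 fun k i _ => ?_, fun n => .of_forall_isOpen (hν.mem n) fun U hU hSU => ?_⟩
  · rw [relInfDist_eq_zero (Set.mem_insert _ _)]
    positivity
  · obtain ⟨k, hk⟩ := exists_subset_of_iInter_subset hclosed hanti hcover hU hSU
    refine (hsupp n k).mono fun x hx => hk fun i hi => ?_
    by_contra! hix
    exact hx i hi (relCutoff_eq_zero (hδ i) hix.le)

end Compact

section Restriction

open LipZero

variable {X : Type*} [MetricSpace X] {x₀ : X} {A : Set X} {a : A}

theorem norm_le_norm_comp_restrictL (ν : StrongDual ℝ (LipZero A a)) :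
    ‖ν‖ ≤ ‖ν.comp (restrictL x₀ a)‖ := by
  refine ν.opNorm_le_bound (norm_nonneg _) fun g => ?_
  obtain ⟨f, hfg, rfl⟩ := exists_restrictL_eq x₀ g
  exact (ν.comp (restrictL x₀ a)).le_opNorm_of_le hfg

theorem delta_comp_restrictL (p : A) :
    (delta a p).comp (restrictL x₀ a) = delta x₀ (p : X) - delta x₀ (a : X) := rfl

theorem isClosed_map_precomp_restrictL (x₀ : X) (a : A) : IsClosed
    ((LipFree A a).map (ContinuousLinearMap.precomp ℝ (restrictL x₀ a)).toLinearMap :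
      Set (StrongDual ℝ (LipZero X x₀))) := by
  have hanti : AntilipschitzWith 1 (ContinuousLinearMap.precomp ℝ (restrictL x₀ a)) :=
    AddMonoidHomClass.antilipschitz_of_bound _ fun ν => by
      rw [NNReal.coe_one, one_mul]
      exact norm_le_norm_comp_restrictL ν
  exact (hanti.isClosedEmbedding
    (ContinuousLinearMap.precomp ℝ (restrictL x₀ a)).uniformContinuous).isClosedMap _
    LipFree.isClosed

theorem SupportedOn.exists_comp_restrictL_eq (hx₀ : x₀ ∈ A) (a : A)
    {μ : StrongDual ℝ (LipZero X x₀)} (hμ : μ ∈ LipFree X x₀) (hA : SupportedOn A μ) :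
    ∃ ν ∈ LipFree A a, ν.comp (restrictL x₀ a) = μ := by
  refine Submodule.topologicalClosure_minimal _ (Submodule.span_le.2 ?_)
    (isClosed_map_precomp_restrictL x₀ a) (hA.mem_topologicalClosure_span hμ)
  rintro _ ⟨p, hp, rfl⟩
  refine ⟨delta a ⟨p, hp⟩ - delta a ⟨x₀, hx₀⟩,
    sub_mem (LipFree.delta_mem _) (LipFree.delta_mem _), ?_⟩
  change (delta a ⟨p, hp⟩ - delta a ⟨x₀, hx₀⟩).comp (restrictL x₀ a) = delta x₀ p
  rw [ContinuousLinearMap.sub_comp, delta_comp_restrictL, delta_comp_restrictL,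
    sub_sub_sub_cancel_right, delta_basepoint, sub_zero]

theorem WeaklyNull.tendsto_zero_of_supportedOn (hx₀ : x₀ ∈ A) (hA : SchurProperty (LipFree A a))
    {μ : ℕ → StrongDual ℝ (LipZero X x₀)} (hμ : WeaklyNull μ) (hsupp : ∀ n, SupportedOn A (μ n)) :
    Tendsto μ atTop (𝓝 0) := by
  choose ν hν hνμ using fun n => (hsupp n).exists_comp_restrictL_eq hx₀ a (hμ.mem n)
  have hlim : Tendsto ν atTop (𝓝 0) := by
    refine schurProperty_lipFree_iff.1 hA ν ⟨hν, fun g => ?_⟩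
    obtain ⟨f, -, rfl⟩ := exists_restrictL_eq x₀ g
    exact (hμ.tendsto f).congr fun n => by rw [← hνμ, ContinuousLinearMap.comp_apply]
  have himage := ((ContinuousLinearMap.precomp ℝ (restrictL x₀ a)).continuous.tendsto 0).comp hlim
  rw [map_zero] at himage
  exact himage.congr hνμ

end Restriction

theorem LocallyModeledOn.mem_of_isCompact {X : Type*} [MetricSpace X]
    {I : Order.Ideal (TopologicalSpace.Closeds X)} {E K : TopologicalSpace.Closeds X}
    (hE : LocallyModeledOn (I : Set (TopologicalSpace.Closeds X)) E) (hKE : K ≤ E)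
    (hK : IsCompact (K : Set X)) : K ∈ I := by
  obtain ⟨A, hA, hKA⟩ : ∃ A ∈ I, (K : Set X) ⊆ A := by
    refine hK.induction_on (p := fun s => ∃ A ∈ I, s ⊆ (A : Set X)) ?_ ?_ ?_ fun x hx => ?_
    · exact ⟨⊥, I.bot_mem, Set.empty_subset _⟩
    · exact fun s t hst ⟨A, hA, htA⟩ => ⟨A, hA, hst.trans htA⟩
    · rintro s t ⟨A, hA, hsA⟩ ⟨B, hB, htB⟩
      refine ⟨A ⊔ B, Order.Ideal.sup_mem hA hB, ?_⟩
      rw [TopologicalSpace.Closeds.coe_sup]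
      exact Set.union_subset_union hsA htB
    · obtain ⟨θ, hθ, hmem⟩ := hE x (hKE hx)
      exact ⟨_, inter_mem_nhdsWithin _ (Metric.closedBall_mem_nhds x hθ), _, hmem,
        Set.inter_subset_inter_left _ hKE⟩
  exact I.lower (show K ≤ A from hKA) hA

theorem mainTheorem2_general {X : Type*} [MetricSpace X] [CompleteSpace X]
    (hX : ∀ K : Set X, IsCompact K → K.Nonempty → ∃ a : K, SchurProperty (LipFree K a)) (x₀ : X) :
    SchurProperty (LipFree X x₀) := by
  refine schurProperty_lipFree_iff.2 fun μ hμ =>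
    tendsto_zero_of_forall_exists_norm_sub_le fun ε hε => ?_
  obtain ⟨ν, K, hν, hμν, hK, hx₀, hsupp⟩ := hμ.exists_compact hε
  obtain ⟨a, hKa⟩ := hX K hK ⟨x₀, hx₀⟩
  exact ⟨ν, hν.tendsto_zero_of_supportedOn hx₀ hKa hsupp, hμν⟩

end

/-- An `Order.Ideal` of the lattice of closed sets is exactly a collection of closed sets that
contains the empty set, is closed under passing to closed subsets and under finite unions. The free
space is formed over each nonempty `A` in `I` with the metric of `X`; up to linear isometry it does
not depend on the basepoint. -/
theorem mainTheorem2 {X : Type*} [MetricSpace X] [CompleteSpace X]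
    (I : Order.Ideal (TopologicalSpace.Closeds X))
    (hX : LocallyModeledOn (I : Set (TopologicalSpace.Closeds X)) ⊤)
    (hI : ∀ A ∈ I, (A : Set X).Nonempty → ∃ a : A, SchurProperty (LipFree A a)) :
    ∀ x₀ : X, SchurProperty (LipFree X x₀) :=
  mainTheorem2_general fun K hK hne => hI ⟨K, hK.isClosed⟩ (hX.mem_of_isCompact le_top hK) hne
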